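/- Let $r\ge 1$. For $s=(s_1,\ldots,s_r)\in\mathbb C^r$ let $$\mathrm{Li}^{\mathrm{sh}}_{s_1,\ldots,s_r}(z_1,\ldots,z_r)=\sum_{l_1,\ldots,l_r\ge 1}\frac{z_1^{l_1}\cdots z_r^{l_r}}{\prod_{j=1}^r(l_1+\cdots+l_j)^{s_j}}\qquad(|z_j|<1)$$ be the shuffle-type multiple polylogarithm, and let $\mathbb B^{(s_1,\ldots,s_r)}_{m_1,\ldots,m_r}$ ($m_1,\ldots,m_r\ge 0$ integers) be the multi-indexed poly-Bernoulli numbers, defined for $(x_1,\ldots,x_r)$ near $0$ by $$\sum_{l_1,\ldots,l_r\ge 1}\frac{\prod_{j=1}^r\bigl(1-e^{-(x_j+\cdots+x_r)}\bigr)^{l_j-1}}{\prod_{j=1}^r(l_1+\cdots+l_j)^{s_j}}=\sum_{m_1,\ldots,m_r\ge 0}\mathbb B^{(s_1,\ldots,s_r)}_{m_1,\ldots,m_r}\frac{x_1^{m_1}\cdots x_r^{m_r}}{m_1!\cdots m_r!}.$$ (The left-hand side is $\mathrm{Li}^{\mathrm{sh}}_{s_1,\ldots,s_r}(z_1,\ldots,z_r)/(z_1\cdots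 z_r)$ at $z_j=1-e^{-(x_j+\cdots+x_r)}$.) Let $k_1,\ldots,k_r\ge 0$ be integers. Then the series $\mathrm{Li}^{\mathrm{sh}}_{-k_1,\ldots,-k_r}$ converges absolutely in the open unit polydisc and has a (unique) holomorphic continuation to $(\mathbb C\setminus[1,\infty))^r$, again denoted $\mathrm{Li}^{\mathrm{sh}}_{-k_1,\ldots,-k_r}$; in the case $s=(-k_1,\ldots,-k_r)$ the generating series above converge absolutely for $(x_1,\ldots,x_r)$ near $0$, so that the numbers $\mathbb B^{(-k_1,\ldots,-k_r)}_{m_1,\ldots,m_r}$ are well defined; and the integral in $$\eta(-k_1,\ldots,-k_r;s_1,\ldots,s_r)=\frac{1}{\prod_{j=1}^r\Gamma(s_j)}\int_0^\infty\!\!\cdots\int_0^\infty\prod_{j=1}^r t_j^{s_j-1}\,\frac{\mathrm{Li}^{\mathrm{sh}}_{-k_1,\ldots,-k_r}\bigl(1-e^{t_1+\cdots+t_r},\ldots,1-e^{t_{r-1}+t_r},1-e^{t_r}\bigr)}{\prod_{j=1}^r\bigl(1-e^{t_j+\cdots+t_r}\bigr)}\,dt_1\cdots dt_r$$ converges absolutely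 for all $s\in\mathbb C^r$ with $\operatorname{Re}(s_j)>0$ $(1\le j\le r)$. The function $\eta(-k_1,\ldots,-k_r;s_1,\ldots,s_r)$ so defined can be analytically continued to an entire function on $\mathbb C^r$, and the continued function satisfies $$\eta(-k_1,\ldots,-k_r;-m_1,\ldots,-m_r)=\mathbb B^{(-k_1,\ldots,-k_r)}_{m_1,\ldots,m_r}\qquad(m_1,\ldots,m_r\in\mathbb Z_{\ge 0}).$$ -/

import Mathlib

open scoped Topology

/-- The general term `∏_j z_j ^ l_j / ∏_j (l_1 + ⋯ + l_j) ^ s_j`, `l_1, …, l_r ≥ 1`, of the series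
of `shuffleLi`; in the code `l j : ℕ` is `l_j - 1`. -/
noncomputable def shuffleLiTerm {r : ℕ} (s z : Fin r → ℂ) (l : Fin r → ℕ) : ℂ :=
  (∏ j, z j ^ (l j + 1)) / ∏ j, ((∑ i ∈ Finset.Iic j, (l i + 1) : ℕ) : ℂ) ^ s j

/-- The same term with each `z_j ^ l_j` replaced by `z_j ^ (l_j - 1)`. -/
noncomputable def reducedShuffleLiTerm {r : ℕ} (s z : Fin r → ℂ) (l : Fin r → ℕ) : ℂ :=
  (∏ j, z j ^ l j) / ∏ j, ((∑ i ∈ Finset.Iic j, (l i + 1) : ℕ) : ℂ) ^ s j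

/-- The terms of the shuffle-type multiple polylogarithm are `∏_j z_j` times the reduced terms. -/
theorem shuffleLiTerm_eq {r : ℕ} (s z : Fin r → ℂ) (l : Fin r → ℕ) :
    shuffleLiTerm s z l = (∏ j, z j) * reducedShuffleLiTerm s z l := by
  simp only [shuffleLiTerm, reducedShuffleLiTerm, pow_succ, Finset.prod_mul_distrib]
  ring

/-- `L` is the shuffle-type multiple polylogarithm of index `s`: in the open unit polydisc it is
the (absolutely convergent) sum of the defining series, and it is holomorphic on
`(ℂ ∖ [1, ∞))^r`. As this domain is connected, these two properties determine `L` on it. -/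
def IsShuffleLi {r : ℕ} (s : Fin r → ℂ) (L : (Fin r → ℂ) → ℂ) : Prop :=
  AnalyticOnNhd ℂ L {z | ∀ j, 1 - z j ∈ Complex.slitPlane} ∧
    ∀ z : Fin r → ℂ, (∀ j, ‖z j‖ < 1) → HasSum (shuffleLiTerm s z) (L z)

/-- The shuffle-type multiple polylogarithm `Li^sh_{s_1,…,s_r}(z_1,…,z_r)`, analytically continued
to `(ℂ ∖ [1, ∞))^r`. -/
noncomputable def shuffleLi {r : ℕ} (s : Fin r → ℂ) : (Fin r → ℂ) → ℂ :=
  Classical.epsilon (IsShuffleLi s)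

/-- The tail sum `x_j + x_{j+1} + ⋯ + x_r`. -/
def tailSum {r : ℕ} {M : Type*} [AddCommMonoid M] (x : Fin r → M) (j : Fin r) : M :=
  ∑ i ∈ Finset.Ici j, x i

/-- The integrand of the `r`-fold Mellin integral,
`∏_j t_j ^ (s_j - 1) * Li^sh_{-k}(1 - e^{t_1 + ⋯ + t_r}, …, 1 - e^{t_r})
  / ∏_j (1 - e^{t_j + ⋯ + t_r})`. -/
noncomputable def etaIntegrand {r : ℕ} (k : Fin r → ℕ) (s : Fin r → ℂ) (t : Fin r → ℝ) : ℂ :=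
  (∏ j, (t j : ℂ) ^ (s j - 1)) *
    (shuffleLi (fun j => -(k j : ℂ)) (fun j => 1 - Complex.exp (tailSum t j : ℝ)) /
      ∏ j, (1 - Complex.exp (tailSum t j : ℝ)))

/-- `η(-k_1,…,-k_r; s_1,…,s_r)` as an integral, for `Re s_j > 0`. -/
noncomputable def etaMellin {r : ℕ} (k : Fin r → ℕ) (s : Fin r → ℂ) : ℂ :=
  (∏ j, Complex.Gamma (s j))⁻¹ *
    ∫ t in {t : Fin r → ℝ | ∀ j, 0 < t j}, etaIntegrand k s t

/-- The point `(1 - e^{-(x_1 + ⋯ + x_r)}, …, 1 - e^{-x_r})`. -/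
noncomputable def bernoulliArg {r : ℕ} (x : Fin r → ℂ) (j : Fin r) : ℂ :=
  1 - Complex.exp (-tailSum x j)

/-- `B` is the family of multi-indexed poly-Bernoulli numbers of upper index `s` (with `d = r`):
for `x` near `0`, with `z_j = 1 - e^{-(x_j + ⋯ + x_r)}`, the function `Li^sh_s(z) / ∏_j z_j`,
given by its absolutely convergent series
`∑_{l_1,…,l_r ≥ 1} ∏_j z_j ^ (l_j - 1) / ∏_j (l_1 + ⋯ + l_j) ^ s_j`,
equals `∑_m B_m ∏_j x_j ^ m_j / m_j!`. -/
def IsMultiPolyBernoulli {r : ℕ} (s : Fin r → ℂ) (B : (Fin r → ℕ) → ℂ) : Prop :=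
  ∀ᶠ x in 𝓝 (0 : Fin r → ℂ),
    Summable (reducedShuffleLiTerm s (bernoulliArg x)) ∧
      HasSum (fun m : Fin r → ℕ => B m * ∏ j, x j ^ m j / ((m j).factorial : ℂ))
        (∑' l : Fin r → ℕ, reducedShuffleLiTerm s (bernoulliArg x) l)

/-- The multi-indexed poly-Bernoulli numbers `𝔹^{(s_1,…,s_r)}_{m_1,…,m_r}`. -/
noncomputable def multiPolyBernoulli {r : ℕ} (s : Fin r → ℂ) : (Fin r → ℕ) → ℂ :=
  Classical.epsilon (IsMultiPolyBernoulli s)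

/-! At nonpositive integer indices everything reduces to a finite sum. The factor `∏_j (l_1 + ⋯ +
l_j) ^ k_j` is a polynomial in `l`, hence a combination of products of binomials `(l_j + a_j).choose
(a_j)` (`exists_choose_expansion`), so `Li^sh / ∏ z_j` equals `∑_a c_a ∏_j (1 - z_j)^{-(a_j + 1)}`.
At `z_j = 1 - e^{-(x_j + ⋯ + x_r)}` this becomes `∑_a c_a ∏_i e^{n_i x_i}` with `n_i = ∑_{j ≤ i}
(a_j + 1) ≥ 1`. Its Taylor coefficients are `∑_a c_a ∏_i n_i ^ m_i`. Putting `x = -t`, the Mellin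
transform splits into Gamma integrals and gives `η(s) = ∑_a c_a ∏_i n_i ^ (-s_i)`, which is entire
and takes these same values at `s = -m`. -/

/-- The product of finitely many convergent series is the sum of the multiple series. -/
theorem hasSum_pi_prod {r : ℕ} {f : Fin r → ℕ → ℂ} {a : Fin r → ℂ}
    (h : ∀ j, HasSum (f j) (a j)) :
    HasSum (fun l : Fin r → ℕ => ∏ j, f j (l j)) (∏ j, a j) := by
  induction r with
  | zero => simp [hasSum_unique]
  | succ r ih =>
    have ht := ih fun j => h j.succ
    rw [← (Fin.consEquiv fun _ => ℕ).hasSum_iff]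
    have hs := summable_mul_of_summable_norm (h 0).summable.norm ht.summable.norm
    simpa [Function.comp_def, Fin.consEquiv, Fin.prod_univ_succ] using (h 0).mul ht hs

/-! ### Uniqueness of the coefficients and of the continuation -/

/-- A power series in several variables whose sum vanishes near the origin has zero
coefficients. -/
theorem coeff_eq_zero_of_hasSum_zero {r : ℕ} {c : (Fin r → ℕ) → ℂ} {ε : ℝ} (hε : 0 < ε)
    (h : ∀ x : Fin r → ℂ, (∀ j, ‖x j‖ < ε) → HasSum (fun m => c m * ∏ j, x j ^ m j) 0) :
    c = 0 := by
  induction r with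
  | zero =>
    ext m
    have := (h 0 (by simp)).unique (hasSum_single m fun m' hm => (hm (Subsingleton.elim _ _)).elim)
    simpa using this.symm
  | succ r ih =>
    have key : ∀ (y : ℂ) (x : Fin r → ℂ), ‖y‖ < ε → (∀ j, ‖x j‖ < ε) →
        HasSum (fun p : ℕ × (Fin r → ℕ) => y ^ p.1 * (c (Fin.cons p.1 p.2) * ∏ j, x j ^ p.2 j))
          0 := by
      intro y x hy hx
      have := h (Fin.cons y x) (fun j => by refine Fin.cases ?_ (fun j => ?_) j <;> simp [hy, hx])
      rw [← (Fin.consEquiv fun _ => ℕ).hasSum_iff] at this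
      convert this using 2 with p
      simp [Fin.consEquiv, Fin.prod_univ_succ]
      ring
    have hinner : ∀ (x : Fin r → ℂ), (∀ j, ‖x j‖ < ε) → ∀ n,
        Summable fun m : Fin r → ℕ => c (Fin.cons n m) * ∏ j, x j ^ m j := by
      intro x hx n
      -- Any nonzero `y` in the disc would do: the row of index `n` is summable after multiplication
      -- by `y ^ n`, which can then be cancelled.
      have hy : ((ε / 2 : ℝ) : ℂ) ≠ 0 := by
        exact_mod_cast (half_pos hε).ne'
      have := (key (ε / 2 : ℝ) x (by
        rw [Complex.norm_real, Real.norm_of_nonneg (half_pos hε).le]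
        exact half_lt_self hε) hx).summable.prod_factor n
      exact (summable_mul_left_iff (pow_ne_zero n hy)).1 this
    have hz : ∀ n (x : Fin r → ℂ), (∀ j, ‖x j‖ < ε) →
        ∑' m : Fin r → ℕ, c (Fin.cons n m) * ∏ j, x j ^ m j = 0 := by
      intro n x hx
      set g : ℕ → ℂ := fun n => ∑' m : Fin r → ℕ, c (Fin.cons n m) * ∏ j, x j ^ m j with hg
      -- For fixed `x`, summing over the rows leaves a one-variable power series in `y` with sum
      -- zero.
      have hp : HasFPowerSeriesAt (0 : ℂ → ℂ) (FormalMultilinearSeries.ofScalars ℂ g) 0 := by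
        rw [hasFPowerSeriesAt_iff]
        filter_upwards [Metric.ball_mem_nhds (0 : ℂ) hε] with y hy
        have hy' : ‖y‖ < ε := by simpa using hy
        have := (key y x hy' hx).prod_fiberwise
          fun n => ((hinner x hx n).hasSum.mul_left (y ^ n))
        simpa [FormalMultilinearSeries.coeff_ofScalars] using this
      have h0 := congrArg (fun p => FormalMultilinearSeries.coeff p n) hp.eq_zero
      exact FormalMultilinearSeries.coeff_ofScalars.symm.trans h0
    ext m
    have := ih (c := fun m' => c (Fin.cons (m 0) m')) fun x hx =>
      hz (m 0) x hx ▸ (hinner x hx (m 0)).hasSum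
    simpa using congrFun this (Fin.tail m)

/-- Identifies the family picked by `Classical.epsilon` with the explicit one. -/
theorem IsMultiPolyBernoulli.unique {r : ℕ} {s : Fin r → ℂ} {B B' : (Fin r → ℕ) → ℂ}
    (h : IsMultiPolyBernoulli s B) (h' : IsMultiPolyBernoulli s B') : B = B' := by
  obtain ⟨ε, hε, hb⟩ := Metric.eventually_nhds_iff.1 (h.and h')
  have := coeff_eq_zero_of_hasSum_zero
    (c := fun m => (B m - B' m) * ∏ j, ((m j).factorial : ℂ)⁻¹) hε fun x hx => by
      obtain ⟨h1, h2⟩ := hb (y := x) (by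
        rw [dist_zero_right]; exact (pi_norm_lt_iff hε).2 hx)
      convert! h1.2.sub h2.2 using 1
      · ext m
        simp only [div_eq_mul_inv, Finset.prod_mul_distrib]
        ring
      · rw [sub_self]
  ext m
  have hm := congrFun this m
  have hne : ∏ j, ((m j).factorial : ℂ)⁻¹ ≠ 0 :=
    Finset.prod_ne_zero_iff.2 fun j _ => inv_ne_zero (by exact_mod_cast (m j).factorial_ne_zero)
  exact sub_eq_zero.1 ((mul_eq_zero.1 hm).resolve_right hne)

theorem isPreconnected_cutDomain (r : ℕ) :
    IsPreconnected {z : Fin r → ℂ | ∀ j, 1 - z j ∈ Complex.slitPlane} := by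
  have : StarConvex ℝ (0 : Fin r → ℂ) {z | ∀ j, 1 - z j ∈ Complex.slitPlane} := by
    intro z hz a b ha hb hab j
    have := Complex.starConvex_one_slitPlane (hz j) ha hb hab
    convert this using 1
    have hab' : (a : ℂ) + b = 1 := by exact_mod_cast hab
    simp
    linear_combination -hab'
  exact (this.isPathConnected (by simp)).isConnected.isPreconnected

theorem IsShuffleLi.eqOn {r : ℕ} {s : Fin r → ℂ} {L L' : (Fin r → ℂ) → ℂ}
    (h : IsShuffleLi s L) (h' : IsShuffleLi s L') :
    Set.EqOn L L' {z | ∀ j, 1 - z j ∈ Complex.slitPlane} := by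
  refine h.1.eqOn_of_preconnected_of_eventuallyEq h'.1 (isPreconnected_cutDomain r)
    (z₀ := 0) (by simp) ?_
  filter_upwards [Metric.ball_mem_nhds (0 : Fin r → ℂ) one_pos] with z hz
  have hz' := (pi_norm_lt_iff one_pos).1 (mem_ball_zero_iff.1 hz)
  exact (h.2 z hz').unique (h'.2 z hz')

/-! ### Rational form of the polylogarithm -/

/-- The product of powers of partial sums is a combination of products of binomial
coefficients, whose generating functions are powers of `1 / (1 - z)`. -/
theorem exists_choose_expansion {r : ℕ} (k : Fin r → ℕ) :
    ∃ c : (Fin r → ℕ) →₀ ℂ, ∀ l : Fin r → ℕ,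
      ∏ j, ((∑ i ∈ Finset.Iic j, (l i + 1) : ℕ) : ℂ) ^ k j =
        c.sum fun a b => b * ∏ j, ((l j + a j).choose (a j) : ℂ) := by
  let v : (Fin r → ℕ) → (Fin r → ℕ) → ℂ := fun a l => ∏ j, ((l j + a j).choose (a j) : ℂ)
  let V := Submodule.span ℂ (Set.range v)
  have hone : (fun _ => 1) ∈ V := Submodule.subset_span ⟨0, by ext; simp [v]⟩
  have hmul : ∀ i, ∀ f ∈ V, (fun l => ((l i : ℂ) + 1) * f l) ∈ V := by
    intro i f hf
    induction hf using Submodule.span_induction with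
    | mem f hf =>
      obtain ⟨a, rfl⟩ := hf
      -- Write `l + 1 = (l + a + 1) - a` and absorb the first factor into the binomial: `(l + a + 1)
      -- * (l + a).choose a = (a + 1) * (l + a + 1).choose (a + 1)`.
      have : (fun l => ((l i : ℂ) + 1) * v a l) =
          ((a i : ℂ) + 1) • v (Function.update a i (a i + 1)) - (a i : ℂ) • v a := by
        ext l
        have h := Nat.add_one_mul_choose_eq (l i + a i) (a i)
        have h' : ((l i : ℂ) + a i + 1) * ((l i + a i).choose (a i) : ℂ) =
            ((l i + (a i + 1)).choose (a i + 1) : ℂ) * (a i + 1) := by exact_mod_cast h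
        have hprod : ∏ j ∈ Finset.univ.erase i, ((l j + Function.update a i (a i + 1) j).choose
              (Function.update a i (a i + 1) j) : ℂ) =
            ∏ j ∈ Finset.univ.erase i, ((l j + a j).choose (a j) : ℂ) :=
          Finset.prod_congr rfl fun j hj => by
            rw [Function.update_of_ne (Finset.ne_of_mem_erase hj)]
        simp only [v, Pi.sub_apply, Pi.smul_apply, smul_eq_mul]
        rw [← Finset.mul_prod_erase _ (fun j => ((l j + Function.update a i (a i + 1) j).choose
            (Function.update a i (a i + 1) j) : ℂ)) (Finset.mem_univ i), hprod,
          Function.update_self,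
          ← Finset.mul_prod_erase _ (fun j => ((l j + a j).choose (a j) : ℂ)) (Finset.mem_univ i)]
        linear_combination (∏ j ∈ Finset.univ.erase i, ((l j + a j).choose (a j) : ℂ)) * h'
      rw [this]
      exact V.sub_mem (V.smul_mem _ (Submodule.subset_span ⟨_, rfl⟩))
        (V.smul_mem _ (Submodule.subset_span ⟨_, rfl⟩))
    | zero =>
      convert V.zero_mem using 1
      ext l
      simp
    | add f g _ _ hf hg =>
      convert V.add_mem hf hg using 1
      ext l
      simp [mul_add]
    | smul b f _ hf =>
      convert V.smul_mem b hf using 1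
      ext l
      simp
      ring
  have hsum : ∀ j, ∀ f ∈ V,
      (fun l : Fin r → ℕ => ((∑ i ∈ Finset.Iic j, (l i + 1) : ℕ) : ℂ) * f l) ∈ V := by
    intro j f hf
    convert V.sum_mem fun i (_ : i ∈ Finset.Iic j) => hmul i f hf using 1
    ext l
    simp [Finset.sum_mul]
  have hpow : ∀ j (n : ℕ), ∀ f ∈ V,
      (fun l : Fin r → ℕ => ((∑ i ∈ Finset.Iic j, (l i + 1) : ℕ) : ℂ) ^ n * f l) ∈ V := by
    intro j n f hf
    induction n with
    | zero => simpa using hf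
    | succ n ih =>
      convert hsum j _ ih using 1
      ext l
      ring
  have hprod : ∀ S : Finset (Fin r),
      (fun l : Fin r → ℕ => ∏ j ∈ S, ((∑ i ∈ Finset.Iic j, (l i + 1) : ℕ) : ℂ) ^ k j) ∈ V := by
    intro S
    induction S using Finset.induction_on with
    | empty => simpa using hone
    | insert j S hj ih =>
      convert hpow j (k j) _ ih using 1
      ext l
      rw [Finset.prod_insert hj]
  obtain ⟨c, hc⟩ := Finsupp.mem_span_range_iff_exists_finsupp.1 (hprod Finset.univ)
  refine ⟨c, fun l => ?_⟩
  have := congrFun hc l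
  simp only [← this, Finsupp.sum, Finset.sum_apply, Pi.smul_apply, smul_eq_mul, v]

/-- The rational function `∑_a c_a ∏_j (1 - z_j)^{-(a_j + 1)}`. -/
noncomputable def inverseOneSubSum {r : ℕ} (c : (Fin r → ℕ) →₀ ℂ) (z : Fin r → ℂ) : ℂ :=
  c.sum fun a b => b * ∏ j, ((1 - z j)⁻¹) ^ (a j + 1)

theorem hasSum_reducedShuffleLiTerm {r : ℕ} {k : Fin r → ℕ} {c : (Fin r → ℕ) →₀ ℂ}
    (hc : ∀ l : Fin r → ℕ, ∏ j, ((∑ i ∈ Finset.Iic j, (l i + 1) : ℕ) : ℂ) ^ k j =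
        c.sum fun a b => b * ∏ j, ((l j + a j).choose (a j) : ℂ))
    {z : Fin r → ℂ} (hz : ∀ j, ‖z j‖ < 1) :
    HasSum (reducedShuffleLiTerm (fun j => -(k j : ℂ)) z) (inverseOneSubSum c z) := by
  have := hasSum_sum fun a (_ : a ∈ c.support) => (hasSum_pi_prod fun j =>
    hasSum_choose_mul_geometric_of_norm_lt_one (a j) (hz j)).mul_left (c a)
  convert! this using 1
  · ext l
    have hcpow : ∏ j, ((∑ i ∈ Finset.Iic j, (l i + 1) : ℕ) : ℂ) ^ (-(k j : ℂ)) =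
        (∏ j, ((∑ i ∈ Finset.Iic j, (l i + 1) : ℕ) : ℂ) ^ k j)⁻¹ := by
      rw [← Finset.prod_inv_distrib]
      exact Finset.prod_congr rfl fun j _ => by rw [Complex.cpow_neg, Complex.cpow_natCast]
    rw [reducedShuffleLiTerm, hcpow, div_inv_eq_mul, hc, Finsupp.sum, Finset.mul_sum]
    refine Finset.sum_congr rfl fun a _ => ?_
    rw [Finset.prod_mul_distrib]
    ring
  · simp [inverseOneSubSum, Finsupp.sum]

theorem isShuffleLi_neg {r : ℕ} {k : Fin r → ℕ} {c : (Fin r → ℕ) →₀ ℂ}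
    (hc : ∀ l : Fin r → ℕ, ∏ j, ((∑ i ∈ Finset.Iic j, (l i + 1) : ℕ) : ℂ) ^ k j =
        c.sum fun a b => b * ∏ j, ((l j + a j).choose (a j) : ℂ)) :
    IsShuffleLi (fun j => -(k j : ℂ)) fun z => (∏ j, z j) * inverseOneSubSum c z := by
  constructor
  · intro z hz
    have hproj : ∀ j, AnalyticAt ℂ (fun z : Fin r → ℂ => z j) z := fun j =>
      (ContinuousLinearMap.proj (R := ℂ) (φ := fun _ : Fin r => ℂ) j).analyticAt z
    refine (Finset.analyticAt_fun_prod _ fun j _ => hproj j).mul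
      (Finset.analyticAt_fun_sum _ fun a _ => analyticAt_const.mul
        (Finset.analyticAt_fun_prod _ fun j _ => ?_))
    exact ((analyticAt_const.sub (hproj j)).inv (Complex.slitPlane_ne_zero (hz j))).pow _
  · intro z hz
    have := (hasSum_reducedShuffleLiTerm hc hz).mul_left (∏ j, z j)
    simpa only [← shuffleLiTerm_eq] using this

/-! ### Exponential substitution and Bernoulli numbers -/

/-- Exchanging the sums over `j ≤ i` turns tail sums of `x` into partial sums of `b`. -/
theorem prod_exp_tailSum {r : ℕ} (x : Fin r → ℂ) (b : Fin r → ℕ) :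
    ∏ j, Complex.exp (tailSum x j) ^ b j =
      ∏ i, Complex.exp ((∑ j ∈ Finset.Iic i, b j : ℕ) * x i) := by
  simp only [← Complex.exp_nat_mul, ← Complex.exp_sum, tailSum, Finset.mul_sum, Nat.cast_sum,
    Finset.sum_mul]
  congr 1
  exact Finset.sum_comm' (by simp)

theorem sum_Iic_add_one_pos {r : ℕ} (a : Fin r → ℕ) (i : Fin r) :
    0 < ∑ j ∈ Finset.Iic i, (a j + 1) :=
  Finset.sum_pos (fun _ _ => Nat.succ_pos _) ⟨i, by simp⟩

theorem inverseOneSubSum_one_sub_exp {r : ℕ} (c : (Fin r → ℕ) →₀ ℂ) (x : Fin r → ℂ) :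
    inverseOneSubSum c (fun j => 1 - Complex.exp (-tailSum x j)) =
      c.sum fun a b => b * ∏ i, Complex.exp ((∑ j ∈ Finset.Iic i, (a j + 1) : ℕ) * x i) := by
  simp only [inverseOneSubSum, sub_sub_cancel, ← Complex.exp_neg, neg_neg, prod_exp_tailSum]

theorem isMultiPolyBernoulli_neg {r : ℕ} {k : Fin r → ℕ} {c : (Fin r → ℕ) →₀ ℂ}
    (hc : ∀ l : Fin r → ℕ, ∏ j, ((∑ i ∈ Finset.Iic j, (l i + 1) : ℕ) : ℂ) ^ k j =
        c.sum fun a b => b * ∏ j, ((l j + a j).choose (a j) : ℂ)) :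
    IsMultiPolyBernoulli (fun j => -(k j : ℂ)) fun m =>
      c.sum fun a b => b * ∏ i, ((∑ j ∈ Finset.Iic i, (a j + 1) : ℕ) : ℂ) ^ m i := by
  have hev : ∀ᶠ x in 𝓝 (0 : Fin r → ℂ), ∀ j, ‖bernoulliArg x j‖ < 1 := by
    refine Filter.eventually_all.2 fun j => ?_
    have hcont : Continuous fun x : Fin r → ℂ => ‖bernoulliArg x j‖ := by
      unfold bernoulliArg tailSum
      fun_prop
    refine hcont.continuousAt.eventually_lt continuousAt_const ?_
    simp [bernoulliArg, tailSum]
  filter_upwards [hev] with x hx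
  have hsum := hasSum_reducedShuffleLiTerm hc hx
  refine ⟨hsum.summable, ?_⟩
  rw [hsum.tsum_eq]
  change HasSum _ (inverseOneSubSum c fun j => 1 - Complex.exp (-tailSum x j))
  rw [inverseOneSubSum_one_sub_exp]
  have := hasSum_sum fun a (_ : a ∈ c.support) => (hasSum_pi_prod fun i =>
    NormedSpace.expSeries_div_hasSum_exp
      (((∑ j ∈ Finset.Iic i, (a j + 1) : ℕ) : ℂ) * x i)).mul_left (c a)
  convert! this using 1
  · ext m
    simp only [Finsupp.sum, Finset.sum_mul]
    refine Finset.sum_congr rfl fun a _ => ?_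
    rw [mul_assoc, ← Finset.prod_mul_distrib]
    congr 1
    exact Finset.prod_congr rfl fun i _ => by rw [mul_pow, mul_div_assoc]
  · simp only [Finsupp.sum, Complex.exp_eq_exp_ℂ]

/-! ### The Mellin integral -/

theorem integrableOn_cpow_mul_exp_neg_mul {s : ℂ} (hs : 0 < s.re) {n : ℝ} (hn : 0 < n) :
    MeasureTheory.IntegrableOn (fun t : ℝ => (t : ℂ) ^ (s - 1) * Complex.exp (-(n * t)))
      (Set.Ioi 0) := by
  -- A non-integrable function has integral `0` by convention, whereas the Gamma integral formula
  -- gives a nonzero value.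
  by_contra h
  have h1 := Complex.integral_cpow_mul_exp_neg_mul_Ioi hs hn
  rw [MeasureTheory.integral_undef h] at h1
  have h2 : (1 / n : ℂ) ≠ 0 := one_div_ne_zero (by exact_mod_cast hn.ne')
  exact mul_ne_zero (Complex.cpow_ne_zero_iff_of_exponent_ne_zero (by
    rintro rfl; simp at hs) |>.2 h2) (Complex.Gamma_ne_zero_of_re_pos hs) h1.symm

theorem volume_restrict_forall_pos (r : ℕ) :
    (MeasureTheory.volume : MeasureTheory.Measure (Fin r → ℝ)).restrict {t | ∀ j, 0 < t j} =
      MeasureTheory.Measure.pi fun _ => MeasureTheory.volume.restrict (Set.Ioi (0 : ℝ)) := by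
  rw [MeasureTheory.volume_pi, ← MeasureTheory.Measure.restrict_pi_pi]
  congr 1
  ext t
  simp

theorem measurableSet_forall_pos (r : ℕ) : MeasurableSet {t : Fin r → ℝ | ∀ j, 0 < t j} := by
  simp only [Set.ofPred_forall]
  exact MeasurableSet.iInter fun j => measurableSet_lt measurable_const (measurable_pi_apply j)

/-- The integrand is a linear combination of products of one-variable Gamma integrands. -/
theorem etaIntegrand_eq {r : ℕ} {k : Fin r → ℕ} {c : (Fin r → ℕ) →₀ ℂ}
    (hc : ∀ l : Fin r → ℕ, ∏ j, ((∑ i ∈ Finset.Iic j, (l i + 1) : ℕ) : ℂ) ^ k j =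
        c.sum fun a b => b * ∏ j, ((l j + a j).choose (a j) : ℂ))
    (s : Fin r → ℂ) {t : Fin r → ℝ} (ht : ∀ j, 0 < t j) :
    etaIntegrand k s t = ∑ a ∈ c.support, c a * ∏ i, ((t i : ℂ) ^ (s i - 1) *
      Complex.exp (-(((∑ j ∈ Finset.Iic i, (a j + 1) : ℕ) : ℝ) * t i))) := by
  have hLi : IsShuffleLi (fun j => -(k j : ℂ)) (shuffleLi fun j => -(k j : ℂ)) :=
    Classical.epsilon_spec ⟨_, isShuffleLi_neg hc⟩
  have hpos : ∀ j, 0 < tailSum t j := fun j => Finset.sum_pos (fun i _ => ht i) ⟨j, by simp⟩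
  have hne : ∏ j, (1 - Complex.exp (tailSum t j : ℝ)) ≠ 0 := by
    refine Finset.prod_ne_zero_iff.2 fun j _ => ?_
    rw [← Complex.ofReal_exp, sub_ne_zero]
    exact_mod_cast (Real.one_lt_exp_iff.2 (hpos j)).ne
  have hneg : (fun j => 1 - Complex.exp (tailSum t j : ℝ)) =
      fun j => 1 - Complex.exp (-tailSum (fun i => -(t i : ℂ)) j) := by
    ext j
    simp [tailSum]
  -- The point may lie outside the unit polydisc, so the continuation is what is evaluated; here `1
  -- - z_j` is a positive exponential.
  have hmem : (fun j => 1 - Complex.exp (tailSum t j : ℝ)) ∈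
      {z : Fin r → ℂ | ∀ j, 1 - z j ∈ Complex.slitPlane} := fun j => by
    rw [sub_sub_cancel, ← Complex.ofReal_exp, Complex.ofReal_mem_slitPlane]
    exact Real.exp_pos _
  rw [etaIntegrand, hLi.eqOn (isShuffleLi_neg hc) hmem, mul_div_cancel_left₀ _ hne, hneg,
    inverseOneSubSum_one_sub_exp, Finsupp.sum, Finset.mul_sum]
  refine Finset.sum_congr rfl fun a _ => ?_
  rw [Finset.prod_mul_distrib, mul_left_comm]
  simp

theorem integrable_prod_cpow_mul_exp {r : ℕ} {s : Fin r → ℂ} (hs : ∀ j, 0 < (s j).re)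
    (a : Fin r → ℕ) :
    MeasureTheory.IntegrableOn (fun t : Fin r → ℝ => ∏ i, ((t i : ℂ) ^ (s i - 1) *
      Complex.exp (-(((∑ j ∈ Finset.Iic i, (a j + 1) : ℕ) : ℝ) * t i))))
      {t | ∀ j, 0 < t j} := by
  rw [MeasureTheory.IntegrableOn, volume_restrict_forall_pos]
  exact MeasureTheory.Integrable.fintype_prod
    (f := fun i (t : ℝ) => (t : ℂ) ^ (s i - 1) *
      Complex.exp (-(((∑ j ∈ Finset.Iic i, (a j + 1) : ℕ) : ℝ) * t))) fun i =>
    integrableOn_cpow_mul_exp_neg_mul (hs i) (by exact_mod_cast sum_Iic_add_one_pos a i)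

theorem integral_prod_cpow_mul_exp {r : ℕ} {s : Fin r → ℂ} (hs : ∀ j, 0 < (s j).re)
    (a : Fin r → ℕ) :
    ∫ t in {t : Fin r → ℝ | ∀ j, 0 < t j}, ∏ i, ((t i : ℂ) ^ (s i - 1) *
      Complex.exp (-(((∑ j ∈ Finset.Iic i, (a j + 1) : ℕ) : ℝ) * t i))) =
    ∏ i, (((∑ j ∈ Finset.Iic i, (a j + 1) : ℕ) : ℂ) ^ (-s i) * Complex.Gamma (s i)) := by
  rw [volume_restrict_forall_pos, MeasureTheory.integral_fintype_prod_eq_prod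
    (f := fun i (t : ℝ) => (t : ℂ) ^ (s i - 1) *
      Complex.exp (-(((∑ j ∈ Finset.Iic i, (a j + 1) : ℕ) : ℝ) * t)))]
  refine Finset.prod_congr rfl fun i _ => ?_
  -- `(1 / n) ^ s = n ^ (-s)` needs `arg n ≠ π`, which holds since `n` is a natural number.
  rw [Complex.integral_cpow_mul_exp_neg_mul_Ioi (hs i)
    (by exact_mod_cast sum_Iic_add_one_pos a i), Complex.ofReal_natCast, one_div,
    Complex.inv_cpow _ _ (by rw [Complex.natCast_arg]; exact Real.pi_pos.ne), Complex.cpow_neg]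

theorem theorem5p3 {r : ℕ} (k : Fin r → ℕ) :
    IsShuffleLi (fun j => -(k j : ℂ)) (shuffleLi fun j => -(k j : ℂ)) ∧
    IsMultiPolyBernoulli (fun j => -(k j : ℂ)) (multiPolyBernoulli fun j => -(k j : ℂ)) ∧
    (∀ s : Fin r → ℂ, (∀ j, 0 < (s j).re) →
      MeasureTheory.IntegrableOn (etaIntegrand k s) {t : Fin r → ℝ | ∀ j, 0 < t j}) ∧
    ∃ η : (Fin r → ℂ) → ℂ,
      AnalyticOnNhd ℂ η Set.univ ∧
      (∀ s : Fin r → ℂ, (∀ j, 0 < (s j).re) → η s = etaMellin k s) ∧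
      ∀ m : Fin r → ℕ,
        η (fun j => -(m j : ℂ)) = multiPolyBernoulli (fun j => -(k j : ℂ)) m := by
  obtain ⟨c, hc⟩ := exists_choose_expansion k
  have hB : IsMultiPolyBernoulli (fun j => -(k j : ℂ))
      (multiPolyBernoulli fun j => -(k j : ℂ)) :=
    Classical.epsilon_spec ⟨_, isMultiPolyBernoulli_neg hc⟩
  refine ⟨Classical.epsilon_spec ⟨_, isShuffleLi_neg hc⟩, hB, fun s hs => ?_,
    fun s => ∑ a ∈ c.support,
      c a * ∏ i, ((∑ j ∈ Finset.Iic i, (a j + 1) : ℕ) : ℂ) ^ (-s i), ?_, fun s hs => ?_,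
    fun m => ?_⟩
  · exact MeasureTheory.IntegrableOn.congr_fun
      (MeasureTheory.integrable_finsetSum _ fun a _ =>
        (integrable_prod_cpow_mul_exp hs a).const_mul (c a))
      (fun t ht => (etaIntegrand_eq hc s ht).symm) (measurableSet_forall_pos r)
  · intro s _
    refine Finset.analyticAt_fun_sum _ fun a _ => analyticAt_const.mul
      (Finset.analyticAt_fun_prod _ fun i _ => ?_)
    refine analyticAt_const.cpow
      ((ContinuousLinearMap.proj (R := ℂ) (φ := fun _ : Fin r => ℂ) i).analyticAt s).neg ?_
    exact Complex.natCast_mem_slitPlane.2 (sum_Iic_add_one_pos a i).ne'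
  · have hG : ∏ j, Complex.Gamma (s j) ≠ 0 :=
      Finset.prod_ne_zero_iff.2 fun j _ => Complex.Gamma_ne_zero_of_re_pos (hs j)
    rw [etaMellin, MeasureTheory.setIntegral_congr_fun (measurableSet_forall_pos r)
      fun t ht => etaIntegrand_eq hc s ht, MeasureTheory.integral_finsetSum _ fun a _ =>
        (integrable_prod_cpow_mul_exp hs a).const_mul (c a), Finset.mul_sum]
    refine Finset.sum_congr rfl fun a _ => ?_
    rw [MeasureTheory.integral_const_mul, integral_prod_cpow_mul_exp hs,
      Finset.prod_mul_distrib]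
    field_simp
  · rw [hB.unique (isMultiPolyBernoulli_neg hc)]
    simp [Finsupp.sum]
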